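/- Let $\mathbb{K}$ be a commutative ring and let $A$ and $B$ be associative unital $\mathbb{K}$-algebras that are flat as $\mathbb{K}$-modules. Write $A\otimes B^{\mathrm{op}}=A\otimes_{\mathbb K}B^{\mathrm{op}}$, and let $\operatorname{Mod}$ denote categories of left modules. For a ring $R$, a *localizing subcategory* $\mathsf{L}\subset\operatorname{Mod}R$ is a full subcategory closed under subobjects, quotients, extensions and arbitrary direct sums. It is *stable* if, whenever $L\subset L'$ is an essential submodule and $L\in\mathsf{L}$, then $L'\in\mathsf{L}$. It is *locally finitely resolved* if the filter of left ideals $\{\mathfrak a\subset R : R/\mathfrak a\in\mathsf{L}\}$ has a cofinal inverse system consisting of left ideals $\mathfrak a$ that possess a resolution $\cdots\to R^{r_1}\to R^{r_0}\to\mathfrak a\to 0$ with all $r_i<\infty$. Let $\mathsf{M}\subset\operatorname{Mod}A$ and $\mathsf{N}\subset\operatorname{Mod}B^{\mathrm{op}}$ be stable, locally finitely resolved localizing subcategories. For an $A\otimes B^{\mathrm{op}}$-module $X$ put $\Gamma_{\mathsf M}X=\{x\in X: A\cdot x\in\mathsf M\}$ and $\Gamma_{\mathsf N}X=\{x\in X: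 B^{\mathrm{op}}\cdot x\in\mathsf N\}$; these are $A\otimes B^{\mathrm{op}}$-submodules of $X$. Let $\mathrm R\Gamma_{\mathsf M},\mathrm R\Gamma_{\mathsf N}:\mathsf D^+(\operatorname{Mod}A\otimes B^{\mathrm{op}})\to\mathsf D^+(\operatorname{Mod}A\otimes B^{\mathrm{op}})$ be the right derived functors, and put $\mathrm H^q_{\mathsf M}=\mathrm H^q\mathrm R\Gamma_{\mathsf M}$, $\mathrm H^q_{\mathsf N}=\mathrm H^q\mathrm R\Gamma_{\mathsf N}$. Suppose $M\in\mathsf D^+(\operatorname{Mod}A\otimes B^{\mathrm{op}})$ satisfies $\mathrm H^q_{\mathsf M}M\in\mathsf N$ (as a $B^{\mathrm{op}}$-module) and $\mathrm H^q_{\mathsf N}M\in\mathsf M$ (as an $A$-module) for all integers $q$. Then there is an isomorphism $$\mathrm R\Gamma_{\mathsf M}M\;\cong\;\mathrm R\Gamma_{\mathsf N}M\quad\text{in }\mathsf D(\operatorname{Mod}A\otimes B^{\mathrm{op}}),$$ functorial in $M$; that is, the restrictions of $\mathrm R\Gamma_{\mathsf M}$ and $\mathrm R\Gamma_{\mathsf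 N}$ to the full subcategory of all such $M$ are naturally isomorphic. -/

import Mathlib

open CategoryTheory Limits
open scoped TensorProduct

universe w v u

noncomputable section

namespace BimoduleSupport

section Localizing

variable {A : Type u} [Ring A]

/-- A localizing subcategory (hereditary torsion class) of the category of left `A`-modules:
a class of modules closed under subobjects, quotients, extensions and arbitrary direct sums. -/
class IsLocalizing (P : ObjectProperty (ModuleCat.{u} A)) : Prop extends P.IsSerreClass where
  closedUnderDirectSums : ∀ J : Type u, P.IsClosedUnderColimitsOfShape (Discrete J)

/-- A submodule `S ⊆ N` is essential if it meets every nonzero submodule nontrivially. -/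
def IsEssentialSubmodule {N : Type u} [AddCommGroup N] [Module A N] (S : Submodule A N) : Prop :=
  ∀ T : Submodule A N, T ≠ ⊥ → S ⊓ T ≠ ⊥

/-- A class of modules is stable if it is closed under essential extensions. -/
def IsStable (P : ObjectProperty (ModuleCat.{u} A)) : Prop :=
  ∀ (N : ModuleCat.{u} A) (S : Submodule A N),
    IsEssentialSubmodule S → P (ModuleCat.of A S) → P N

/-- The filter of left ideals `𝔞` of `A` such that `A / 𝔞` lies in `P`. -/
def idealFilter (P : ObjectProperty (ModuleCat.{u} A)) : Set (Submodule A A) :=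
  {a | P (ModuleCat.of A (A ⧸ a))}

variable (A) in
/-- A module `M` is finitely resolved if it has a resolution
`⋯ → A ^ r₂ → A ^ r₁ → A ^ r₀ → M → 0` by free modules of finite rank. -/
def IsFinitelyResolved (M : Type u) [AddCommGroup M] [Module A M] : Prop :=
  ∃ (r : ℕ → ℕ) (d : ∀ n, (Fin (r (n + 1)) → A) →ₗ[A] (Fin (r n) → A))
    (ε : (Fin (r 0) → A) →ₗ[A] M),
    Function.Surjective ε ∧ Function.Exact (d 0) ε ∧ ∀ n, Function.Exact (d (n + 1)) (d n)

/-- `P` is locally finitely resolved if the filter of left ideals of `P` has a cofinal inverse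
system (a subset directed by reverse inclusion, such that every member of the filter contains
one of its elements) consisting of left ideals that are finitely resolved as modules. -/
def IsLocallyFinitelyResolved (P : ObjectProperty (ModuleCat.{u} A)) : Prop :=
  ∃ F ⊆ idealFilter P, DirectedOn (· ≥ ·) F ∧ (∀ a ∈ idealFilter P, ∃ b ∈ F, b ≤ a) ∧
    ∀ b ∈ F, IsFinitelyResolved A b

section Torsion

variable (P : ObjectProperty (ModuleCat.{u} A)) {M N : Type u}
  [AddCommGroup M] [Module A M] [AddCommGroup N] [Module A N]

/-- The condition `A ∙ m ∈ P` on an element `m` of an `A`-module. -/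
def IsSupported (m : M) : Prop := P (ModuleCat.of A (Submodule.span A {m}))

variable [IsLocalizing P]

variable {P} in
lemma IsSupported.of_prop (h : P (ModuleCat.of A M)) (m : M) : IsSupported P m :=
  have := (ModuleCat.mono_iff_injective (ModuleCat.ofHom (Submodule.span A {m}).subtype)).2
    (Submodule.subtype_injective _)
  P.prop_of_mono (ModuleCat.ofHom (Submodule.span A {m}).subtype) h

variable {P} in
lemma prop_of_le {S T : Submodule A M} (h : S ≤ T) (hT : P (ModuleCat.of A T)) :
    P (ModuleCat.of A S) :=
  have := (ModuleCat.mono_iff_injective (ModuleCat.ofHom (Submodule.inclusion h))).2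
    (Submodule.inclusion_injective h)
  P.prop_of_mono (ModuleCat.ofHom (Submodule.inclusion h)) hT

variable {P} in
lemma prop_map (f : M →ₗ[A] N) {S : Submodule A M} (hS : P (ModuleCat.of A S)) :
    P (ModuleCat.of A (S.map f)) :=
  have := (ModuleCat.epi_iff_surjective (ModuleCat.ofHom (f.submoduleMap S))).2
    (f.submoduleMap_surjective S)
  P.prop_of_epi (ModuleCat.ofHom (f.submoduleMap S)) hS

variable {P} in
lemma IsSupported.map {m : M} (h : IsSupported P m) (f : M →ₗ[A] N) : IsSupported P (f m) := by
  have := prop_map f h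
  rwa [Submodule.map_span, Set.image_singleton] at this

variable {P} in
lemma IsSupported.smul {m : M} (h : IsSupported P m) (a : A) : IsSupported P (a • m) :=
  prop_of_le (Submodule.span_le.2 (by
    simpa using Submodule.smul_mem _ a (Submodule.mem_span_singleton_self m))) h

lemma IsSupported.zero : IsSupported P (0 : M) := by
  refine P.prop_of_isZero ?_
  have : Subsingleton (Submodule.span A {(0 : M)}) := by
    rw [Submodule.span_zero_singleton]; infer_instance
  exact ModuleCat.isZero_of_subsingleton _

variable {P} in
lemma IsSupported.add {m n : M} (hm : IsSupported P m) (hn : IsSupported P n) :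
    IsSupported P (m + n) := by
  let S := Submodule.span A {m}
  let T := Submodule.span A {n}
  have hST : P (ModuleCat.of A (S × T)) := by
    let E : ShortComplex (ModuleCat.{u} A) := ShortComplex.mk
      (ModuleCat.ofHom (LinearMap.inl A S T)) (ModuleCat.ofHom (LinearMap.snd A S T)) (by
        ext x; rfl)
    have hE : E.ShortExact :=
      { exact := (ShortComplex.ShortExact.moduleCat_exact_iff_function_exact E).2 (by
          exact .inl_snd)
        mono_f := (ModuleCat.mono_iff_injective _).2 LinearMap.inl_injective
        epi_g := (ModuleCat.epi_iff_surjective _).2 LinearMap.snd_surjective }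
    exact P.prop_X₂_of_shortExact hE hm hn
  have h := IsSupported.of_prop hST
    (⟨m, Submodule.mem_span_singleton_self m⟩, ⟨n, Submodule.mem_span_singleton_self n⟩)
  simpa using h.map (S.subtype.coprod T.subtype)

end Torsion

end Localizing

section Bimodules

variable {K : Type v} [CommRing K] {A B : Type u} [Ring A] [Ring B] [Algebra K A] [Algebra K B]

/-- The category of `K`-central `A`-`B`-bimodules, i.e. of left `A ⊗[K] Bᵐᵒᵖ`-modules. -/
abbrev Bimod (K : Type v) [CommRing K] (A B : Type u) [Ring A] [Ring B]
    [Algebra K A] [Algebra K B] := ModuleCat.{u} (A ⊗[K] Bᵐᵒᵖ)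

variable (K A B) in
/-- The forgetful functor from bimodules to left `A`-modules. -/
abbrev forgetToLeft : Bimod K A B ⥤ ModuleCat.{u} A :=
  ModuleCat.restrictScalars
    (Algebra.TensorProduct.includeLeft : A →ₐ[K] A ⊗[K] Bᵐᵒᵖ).toRingHom

variable (K A B) in
/-- The forgetful functor from bimodules to left `Bᵐᵒᵖ`-modules, i.e. right `B`-modules. -/
abbrev forgetToRight : Bimod K A B ⥤ ModuleCat.{u} Bᵐᵒᵖ :=
  ModuleCat.restrictScalars
    (Algebra.TensorProduct.includeRight : Bᵐᵒᵖ →ₐ[K] A ⊗[K] Bᵐᵒᵖ).toRingHom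

/-- The sub-bimodule `Γ_P X = {x ∈ X | A ∙ x ∈ P}` of a bimodule `X`, for a localizing
subcategory `P` of the category of left `A`-modules. -/
def leftTorsion (P : ObjectProperty (ModuleCat.{u} A)) [IsLocalizing P] (X : Bimod K A B) :
    Submodule (A ⊗[K] Bᵐᵒᵖ) X where
  carrier := {x | IsSupported (M := (forgetToLeft K A B).obj X) P x}
  add_mem' := IsSupported.add (M := (forgetToLeft K A B).obj X)
  zero_mem' := IsSupported.zero (M := (forgetToLeft K A B).obj X) P
  smul_mem' r x hx := by
    let M := (forgetToLeft K A B).obj X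
    change IsSupported (M := M) P ((r • x : X) : M)
    induction r using TensorProduct.induction_on with
    | zero =>
      have e : (0 : A ⊗[K] Bᵐᵒᵖ) • x = 0 := zero_smul (A ⊗[K] Bᵐᵒᵖ) x
      rw [e]
      exact IsSupported.zero (M := M) P
    | add r s hr hs =>
      have e : (r + s) • x = r • x + s • x := add_smul r s x
      rw [e]
      exact IsSupported.add (M := M) hr hs
    | tmul a b =>
      have comm : ∀ (c : A) (y : X), ((1 : A) ⊗ₜ[K] b) • ((c ⊗ₜ[K] (1 : Bᵐᵒᵖ)) • y) = (c ⊗ₜ[K] (1 : Bᵐᵒᵖ)) • (((1 : A) ⊗ₜ[K] b) • y) := by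
        intro c y
        rw [smul_smul, smul_smul]
        simp
      let f : M →ₗ[A] M :=
        { toFun := fun y ↦ (((1 : A) ⊗ₜ[K] b) • (y : X) : X)
          map_add' := fun y z ↦ smul_add ((1 : A) ⊗ₜ[K] b) (y : X) (z : X)
          map_smul' := comm }
      have h := (IsSupported.map (M := M) hx f).smul a
      have e : (a ⊗ₜ[K] b) • x = (a ⊗ₜ[K] (1 : Bᵐᵒᵖ)) • (((1 : A) ⊗ₜ[K] b) • x) := by
        rw [smul_smul]
        simp
      rw [e]
      exact h

/-- The sub-bimodule `Γ_Q X = {x ∈ X | Bᵐᵒᵖ ∙ x ∈ Q}` of a bimodule `X`, for a localizing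
subcategory `Q` of the category of left `Bᵐᵒᵖ`-modules. -/
def rightTorsion (Q : ObjectProperty (ModuleCat.{u} Bᵐᵒᵖ)) [IsLocalizing Q] (X : Bimod K A B) :
    Submodule (A ⊗[K] Bᵐᵒᵖ) X where
  carrier := {x | IsSupported (M := (forgetToRight K A B).obj X) Q x}
  add_mem' := IsSupported.add (M := (forgetToRight K A B).obj X)
  zero_mem' := IsSupported.zero (M := (forgetToRight K A B).obj X) Q
  smul_mem' r x hx := by
    let M := (forgetToRight K A B).obj X
    change IsSupported (M := M) Q ((r • x : X) : M)
    induction r using TensorProduct.induction_on with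
    | zero =>
      have e : (0 : A ⊗[K] Bᵐᵒᵖ) • x = 0 := zero_smul (A ⊗[K] Bᵐᵒᵖ) x
      rw [e]
      exact IsSupported.zero (M := M) Q
    | add r s hr hs =>
      have e : (r + s) • x = r • x + s • x := add_smul r s x
      rw [e]
      exact IsSupported.add (M := M) hr hs
    | tmul a b =>
      have comm : ∀ (c : Bᵐᵒᵖ) (y : X), (a ⊗ₜ[K] (1 : Bᵐᵒᵖ)) • (((1 : A) ⊗ₜ[K] c) • y) = ((1 : A) ⊗ₜ[K] c) • ((a ⊗ₜ[K] (1 : Bᵐᵒᵖ)) • y) := by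
        intro c y
        rw [smul_smul, smul_smul]
        simp
      let f : M →ₗ[Bᵐᵒᵖ] M :=
        { toFun := fun y ↦ ((a ⊗ₜ[K] (1 : Bᵐᵒᵖ)) • (y : X) : X)
          map_add' := fun y z ↦ smul_add (a ⊗ₜ[K] (1 : Bᵐᵒᵖ)) (y : X) (z : X)
          map_smul' := comm }
      have h := (IsSupported.map (M := M) hx f).smul b
      have e : (a ⊗ₜ[K] b) • x = ((1 : A) ⊗ₜ[K] b) • ((a ⊗ₜ[K] (1 : Bᵐᵒᵖ)) • x) := by
        rw [smul_smul]
        simp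
      rw [e]
      exact h

variable (K B) in
/-- The torsion functor `Γ_P` on bimodules, a subfunctor of the identity. -/
def leftΓ (P : ObjectProperty (ModuleCat.{u} A)) [IsLocalizing P] :
    Bimod K A B ⥤ Bimod K A B where
  obj X := ModuleCat.of _ (leftTorsion P X)
  map {X Y} f := ModuleCat.ofHom (f.hom.restrict (p := leftTorsion P X) (q := leftTorsion P Y)
    fun _ hx ↦ IsSupported.map (M := (forgetToLeft K A B).obj X)
      (N := (forgetToLeft K A B).obj Y) hx ((forgetToLeft K A B).map f).hom)

variable (K A) in
/-- The torsion functor `Γ_Q` on bimodules, a subfunctor of the identity. -/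
def rightΓ (Q : ObjectProperty (ModuleCat.{u} Bᵐᵒᵖ)) [IsLocalizing Q] :
    Bimod K A B ⥤ Bimod K A B where
  obj X := ModuleCat.of _ (rightTorsion Q X)
  map {X Y} f := ModuleCat.ofHom (f.hom.restrict (p := rightTorsion Q X) (q := rightTorsion Q Y)
    fun _ hx ↦ IsSupported.map (M := (forgetToRight K A B).obj X)
      (N := (forgetToRight K A B).obj Y) hx ((forgetToRight K A B).map f).hom)

instance (P : ObjectProperty (ModuleCat.{u} A)) [IsLocalizing P] :
    (leftΓ K B P).Additive where

instance (Q : ObjectProperty (ModuleCat.{u} Bᵐᵒᵖ)) [IsLocalizing Q] :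
    (rightΓ K A Q).Additive where

variable [HasDerivedCategory.{w} (Bimod K A B)]

variable (K B) in
/-- The right derived functor `RΓ_P` on the bounded below derived category of bimodules. -/
abbrev leftRΓ (P : ObjectProperty (ModuleCat.{u} A)) [IsLocalizing P] :
    DerivedCategory.Plus (Bimod K A B) ⥤ DerivedCategory.Plus (Bimod K A B) :=
  (leftΓ K B P).rightDerivedFunctorPlus

variable (K A) in
/-- The right derived functor `RΓ_Q` on the bounded below derived category of bimodules. -/
abbrev rightRΓ (Q : ObjectProperty (ModuleCat.{u} Bᵐᵒᵖ)) [IsLocalizing Q] :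
    DerivedCategory.Plus (Bimod K A B) ⥤ DerivedCategory.Plus (Bimod K A B) :=
  (rightΓ K A Q).rightDerivedFunctorPlus

variable (K) in
/-- The complexes of bimodules `X`, bounded below, such that for all integers `q` the cohomology
`H^q_P X = H^q (RΓ_P X)` lies in `Q` as a `Bᵐᵒᵖ`-module, and the cohomology
`H^q_Q X = H^q (RΓ_Q X)` lies in `P` as an `A`-module. -/
def crossSupported (P : ObjectProperty (ModuleCat.{u} A)) [IsLocalizing P]
    (Q : ObjectProperty (ModuleCat.{u} Bᵐᵒᵖ)) [IsLocalizing Q] :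
    ObjectProperty (DerivedCategory.Plus (Bimod K A B)) := fun X ↦
  ∀ q : ℤ,
    Q ((forgetToRight K A B).obj
      ((DerivedCategory.Plus.homologyFunctor _ q).obj ((leftRΓ K B P).obj X))) ∧
    P ((forgetToLeft K A B).obj
      ((DerivedCategory.Plus.homologyFunctor _ q).obj ((rightRΓ K A Q).obj X)))

end Bimodules

end BimoduleSupport

end

/-!
Flatness of `B` makes restriction of scalars from bimodules to `A` preserve injectives, as its left
adjoint is exact. So for an injective bimodule `X`, stability makes `Γ X` injective over `A`, hence
`X / Γ X` is both injective and torsion-free over `A`. A bounded below complex of torsion-free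
injectives with torsion cohomology is acyclic, by splitting it degree by degree; hence `RΓ ⟶ 𝟭` is
invertible on complexes with torsion cohomology and exhibits `RΓ` as a coreflection onto them. Two
coreflections agree on an object which each of them sends into both of the subcategories, by their
universal properties.
-/

namespace BimoduleSupport

section Coreflection

variable {D : Type*} [Category* D] {Γ Γ₁ Γ₂ : D ⥤ D}

/-- The counit `c : Γ ⟶ 𝟭 D` exhibits `Γ` as a coreflection of `D` onto the full subcategory of
objects satisfying `P`, i.e. as a right adjoint of its inclusion. -/
structure IsCoreflection (c : Γ ⟶ 𝟭 D) (P : ObjectProperty D) : Prop where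
  prop_obj (X : D) : P (Γ.obj X)
  isIso_app {X : D} (hX : P X) : IsIso (c.app X)
  isIso_map_app (X : D) : IsIso (Γ.map (c.app X))

namespace IsCoreflection

variable {c : Γ ⟶ 𝟭 D} {P : ObjectProperty D} {W X : D}

lemma hom_ext (h : IsCoreflection c P) (hW : P W) {f g : W ⟶ Γ.obj X}
    (hfg : f ≫ c.app X = g ≫ c.app X) : f = g := by
  have := h.isIso_app hW
  have := h.isIso_map_app X
  have hΓ : Γ.map f = Γ.map g := by
    rw [← cancel_mono (Γ.map (c.app X)), ← Γ.map_comp, ← Γ.map_comp, hfg]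
  have comm (k : W ⟶ Γ.obj X) : Γ.map k ≫ c.app (Γ.obj X) = c.app W ≫ k := c.naturality k
  rw [← cancel_epi (c.app W), ← comm f, ← comm g, hΓ]

/-- The factorization through `Γ` of a morphism from an object of the coreflective subcategory. -/
noncomputable def lift (h : IsCoreflection c P) (hW : P W) (f : W ⟶ X) : W ⟶ Γ.obj X :=
  have := h.isIso_app hW
  inv (c.app W) ≫ Γ.map f

@[simp]
lemma lift_comp (h : IsCoreflection c P) (hW : P W) (f : W ⟶ X) :
    h.lift hW f ≫ c.app X = f := by
  have := h.isIso_app hW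
  have comm : Γ.map f ≫ c.app X = c.app W ≫ f := c.naturality f
  simp [lift, comm]

end IsCoreflection

variable {c₁ : Γ₁ ⟶ 𝟭 D} {c₂ : Γ₂ ⟶ 𝟭 D} {P₁ P₂ : ObjectProperty D}

/-- Two coreflections agree on objects which each of them sends into both subcategories. -/
noncomputable def coreflectionIso {E : Type*} [Category* E] (G : E ⥤ D)
    (h₁ : IsCoreflection c₁ P₁) (h₂ : IsCoreflection c₂ P₂)
    (hG₁ : ∀ X, P₂ (Γ₁.obj (G.obj X))) (hG₂ : ∀ X, P₁ (Γ₂.obj (G.obj X))) :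
    G ⋙ Γ₁ ≅ G ⋙ Γ₂ :=
  NatIso.ofComponents
    (fun X ↦
      { hom := h₂.lift (hG₁ X) (c₁.app _)
        inv := h₁.lift (hG₂ X) (c₂.app _)
        hom_inv_id := h₁.hom_ext (h₁.prop_obj _) (by simp)
        inv_hom_id := h₂.hom_ext (h₂.prop_obj _) (by simp) })
    (fun f ↦ h₂.hom_ext (hG₁ _) (by
      have comm₁ := c₁.naturality (G.map f)
      have comm₂ := c₂.naturality (G.map f)
      dsimp at comm₁ comm₂
      dsimp
      rw [Category.assoc, h₂.lift_comp, Category.assoc, comm₂, comm₁, ← Category.assoc,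
        h₂.lift_comp]))

end Coreflection

section TorsionFree

variable {C : Type*} [Category* C] [Abelian C] {P : ObjectProperty C}

lemma rightOrthogonal_of_mono {X Y : C} (hY : P.rightOrthogonal Y) (i : X ⟶ Y) [Mono i] :
    P.rightOrthogonal X := fun W f hW ↦ by
  rw [← cancel_mono i, hY (f ≫ i) hW, zero_comp]

/-- The splitting of a short exact sequence with injective kernel, as a retraction onto its
cokernel. -/
noncomputable def retractOfInjective {S : ShortComplex C} (hS : S.ShortExact) [Injective S.X₁] :
    Retract S.X₃ S.X₂ where
  i := hS.splittingOfInjective.s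
  r := S.g
  retract := hS.splittingOfInjective.s_g

lemma fromOpcycles_pOpcycles (K : CochainComplex C ℤ) (m n : ℤ) :
    K.fromOpcycles m n ≫ K.pOpcycles n = 0 := by
  rw [← cancel_epi (K.pOpcycles m)]
  simp

lemma shortExact_opcycles (K : CochainComplex C ℤ) {m n : ℤ} (hmn : m + 1 = n)
    (hm : K.ExactAt m) :
    (ShortComplex.mk _ _ (fromOpcycles_pOpcycles K m n)).ShortExact where
  exact := by
    have hd : (ShortComplex.mk (K.d m n) (K.pOpcycles n) (by simp)).Exact :=
      ShortComplex.exact_of_g_is_cokernel _ (K.opcyclesIsCokernel m n (by simp [← hmn]))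
    let φ : ShortComplex.mk (K.d m n) (K.pOpcycles n) (by simp) ⟶
        ShortComplex.mk _ _ (fromOpcycles_pOpcycles K m n) :=
      { τ₁ := K.pOpcycles m
        τ₂ := 𝟙 _
        τ₃ := 𝟙 _ }
    have : Epi φ.τ₁ := inferInstanceAs (Epi (K.pOpcycles m))
    have : IsIso φ.τ₂ := inferInstanceAs (IsIso (𝟙 _))
    have : Mono φ.τ₃ := inferInstanceAs (Mono (𝟙 _))
    exact (ShortComplex.exact_iff_of_epi_of_isIso_of_mono φ).1 hd
  mono_f := Preadditive.mono_of_isZero_kernel' _ (K.homologyIsKernel m n (by simp [← hmn]))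
    hm.isZero_homology
  epi_g := inferInstanceAs (Epi (K.pOpcycles n))

lemma acyclic_of_rightOrthogonal [P.IsSerreClass] (K : CochainComplex C ℤ) (n₀ : ℤ)
    [K.IsStrictlyGE n₀] (hI : ∀ n, Injective (K.X n)) (hK : ∀ n, P.rightOrthogonal (K.X n))
    (hP : ∀ n, P (K.homology n)) : K.Acyclic := by
  have hz (n : ℤ) (hn : n < n₀) : IsZero (K.X n) := K.isZero_of_isStrictlyGE n₀ n hn
  have exactAt (m : ℤ) (h : P.rightOrthogonal (K.opcycles m)) : K.ExactAt m := by
    rw [K.exactAt_iff_isZero_homology, IsZero.iff_id_eq_zero, ← cancel_mono (K.homologyι m),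
      h (K.homologyι m) (hP m), comp_zero, comp_zero]
  have opcycles (m : ℤ) (hm : n₀ - 1 ≤ m) :
      P.rightOrthogonal (K.opcycles m) ∧ Injective (K.opcycles m) := by
    induction m, hm using Int.leInduction with
    | base =>
      have hO : IsZero (K.opcycles (n₀ - 1)) :=
        (hz _ (by lia)).of_epi (K.pOpcycles (n₀ - 1))
      exact ⟨P.rightOrthogonal.prop_of_isZero hO, hO.injective⟩
    | succ m _ ih =>
      have : Injective (K.opcycles m) := ih.2
      have := hI (m + 1)
      let r := retractOfInjective (shortExact_opcycles K rfl (exactAt m ih.1))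
      exact ⟨rightOrthogonal_of_mono (hK (m + 1)) r.i, r.injective⟩
  intro n
  by_cases hn : n₀ - 1 ≤ n
  · exact exactAt n (opcycles n hn).1
  · exact .of_isZero (hz n (by lia))

end TorsionFree

section Complexes

variable {C D : Type*} [Category* C] [Category* D] [Abelian C] [Abelian D]

lemma quasiIso_of_shortExact_of_acyclic {S : ShortComplex (CochainComplex C ℤ)}
    (hS : S.ShortExact) (h : S.X₃.Acyclic) : QuasiIso S.f where
  quasiIsoAt n := by
    have hX₃ (m : ℤ) : IsZero (S.X₃.homology m) := (h m).isZero_homology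
    have : Mono (HomologicalComplex.homologyMap S.f n) :=
      (hS.homology_exact₁ (n - 1) n (by simp)).mono_g ((hX₃ _).eq_of_src _ _)
    have : Epi (HomologicalComplex.homologyMap S.f n) :=
      (hS.homology_exact₂ n).epi_f ((hX₃ _).eq_of_tgt _ _)
    rw [quasiIsoAt_iff_isIso_homologyMap]
    exact isIso_of_mono_of_epi _

lemma acyclic_map_iff (F : C ⥤ D) [F.Additive] [F.Faithful] [PreservesFiniteLimits F]
    [PreservesFiniteColimits F] (K : CochainComplex C ℤ) :
    ((F.mapHomologicalComplex (.up ℤ)).obj K).Acyclic ↔ K.Acyclic :=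
  forall_congr' fun n ↦ (K.sc n).exact_map_iff_of_faithful F

lemma prop_homology (P : ObjectProperty C) [P.IsSerreClass] (K : CochainComplex C ℤ) (n : ℤ)
    (h : P (K.X n)) : P (K.homology n) :=
  P.prop_of_epi (K.homologyπ n) (P.prop_of_mono (K.iCycles n) h)

variable {Γ : C ⥤ C} [Γ.Additive]

/-- The natural transformation on cochain complexes given in each degree by `i : Γ ⟶ 𝟭 C`. -/
def cochainComplexToId (i : Γ ⟶ 𝟭 C) :
    Γ.mapHomologicalComplex (.up ℤ) ⟶ 𝟭 (CochainComplex C ℤ) where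
  app K :=
    { f n := i.app (K.X n)
      comm' _ _ _ := (i.naturality _).symm }
  naturality _ _ f := by
    ext n
    exact i.naturality (f.f n)

/-- The natural transformation on bounded below homotopy categories induced by `i : Γ ⟶ 𝟭 C`. -/
def homotopyCategoryToId (i : Γ ⟶ 𝟭 C) :
    Γ.mapHomotopyCategoryPlus ⟶ 𝟭 (HomotopyCategory.Plus C) where
  app K := ObjectProperty.homMk
    ((HomotopyCategory.quotient C (.up ℤ)).map ((cochainComplexToId i).app K.obj.as))
  naturality K L f := by
    obtain ⟨K, rfl⟩ := HomotopyCategory.Plus.quotient_obj_surjective K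
    obtain ⟨L, rfl⟩ := HomotopyCategory.Plus.quotient_obj_surjective L
    obtain ⟨f, rfl⟩ := (HomotopyCategory.Plus.quotient C).map_surjective f
    ext
    exact (HomotopyCategory.quotient C (.up ℤ)).congr_map
      ((cochainComplexToId i).naturality f.hom)

end Complexes

section StableTorsion

variable {C D : Type*} [Category* C] [Category* D] [Abelian C] [Abelian D] {Γ : C ⥤ C}

/-- A subfunctor `i : Γ ⟶ 𝟭 C` of the identity is a stable torsion functor for a class `P` of
objects of `D`, along an exact functor `F : C ⥤ D`, if it is idempotent, if its values lie in `P`,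
and if `F` sends the quotient `X / Γ X` of an injective object `X` to a torsion-free injective
object. -/
structure IsStableTorsion (i : Γ ⟶ 𝟭 C) (F : C ⥤ D) (P : ObjectProperty D) : Prop where
  mono_app (X : C) : Mono (i.app X)
  isIso_app (X : C) : IsIso (i.app (Γ.obj X))
  prop_obj (X : C) : P (F.obj (Γ.obj X))
  rightOrthogonal (X : C) [Injective X] : P.rightOrthogonal (F.obj (cokernel (i.app X)))
  injective (X : C) [Injective X] : Injective (F.obj (cokernel (i.app X)))

namespace IsStableTorsion

variable {i : Γ ⟶ 𝟭 C} {F : C ⥤ D} {P : ObjectProperty D}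

lemma isIso_map_app (h : IsStableTorsion i F P) (X : C) : IsIso (Γ.map (i.app X)) := by
  have := h.mono_app X
  have : Γ.map (i.app X) = i.app (Γ.obj X) := by
    rw [← cancel_mono (i.app X)]
    exact i.naturality (i.app X)
  rw [this]
  exact h.isIso_app X

variable [Γ.Additive] [PreservesFiniteLimits F] [PreservesFiniteColimits F] [P.IsSerreClass]

lemma prop_homology (h : IsStableTorsion i F P) (K : CochainComplex C ℤ) (n : ℤ) :
    P (F.obj (((Γ.mapHomologicalComplex (.up ℤ)).obj K).homology n)) :=
  BimoduleSupport.prop_homology (P.inverseImage F) ((Γ.mapHomologicalComplex (.up ℤ)).obj K) n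
    (h.prop_obj (K.X n))

omit [PreservesFiniteLimits F] [PreservesFiniteColimits F] [P.IsSerreClass] in
lemma shortExact (h : IsStableTorsion i F P) (K : CochainComplex C ℤ) :
    (ShortComplex.mk _ _ (cokernel.condition ((cochainComplexToId i).app K))).ShortExact where
  exact := ShortComplex.exact_cokernel _
  mono_f :=
    HomologicalComplex.mono_of_mono_f _ fun n ↦ h.mono_app (K.X n)
  epi_g := inferInstanceAs (Epi (cokernel.π _))

variable [F.Additive] [F.Faithful]

lemma acyclic_cokernel (h : IsStableTorsion i F P) (K : CochainComplex C ℤ) (n₀ : ℤ)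
    [K.IsStrictlyGE n₀] (hI : ∀ n, Injective (K.X n)) (hK : ∀ n, P (F.obj (K.homology n))) :
    (cokernel ((cochainComplexToId i).app K)).Acyclic := by
  let Q := cokernel ((cochainComplexToId i).app K)
  let e (n : ℤ) : Q.X n ≅ cokernel (i.app (K.X n)) :=
    PreservesCokernel.iso (HomologicalComplex.eval C (.up ℤ) n) ((cochainComplexToId i).app K)
  have : CochainComplex.IsStrictlyGE Q n₀ := (CochainComplex.isStrictlyGE_iff _ _).2 fun n hn ↦
    ((K.isZero_of_isStrictlyGE n₀ n hn).of_epi (cokernel.π (i.app (K.X n)))).of_iso (e n)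
  rw [← acyclic_map_iff F]
  refine acyclic_of_rightOrthogonal (P := P) _ n₀ (fun n ↦ ?_) (fun n ↦ ?_) (fun n ↦ ?_)
  · exact Injective.of_iso (F.mapIso (e n)).symm (h.injective (K.X n))
  · exact P.rightOrthogonal.prop_of_iso (F.mapIso (e n)).symm (h.rightOrthogonal (K.X n))
  · exact P.prop_of_iso ((Q.sc n).mapHomologyIso F).symm ((P.inverseImage F).prop_X₂_of_exact
      ((h.shortExact K).homology_exact₃ n (n + 1) rfl) (hK n) (h.prop_homology K (n + 1)))

lemma quasiIso (h : IsStableTorsion i F P) (K : CochainComplex C ℤ) (n₀ : ℤ)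
    [K.IsStrictlyGE n₀] (hI : ∀ n, Injective (K.X n)) (hK : ∀ n, P (F.obj (K.homology n))) :
    QuasiIso ((cochainComplexToId i).app K) :=
  quasiIso_of_shortExact_of_acyclic (h.shortExact K) (h.acyclic_cokernel K n₀ hI hK)

end IsStableTorsion

end StableTorsion

section Derived

open DerivedCategory.Plus (Qh homologyFunctor)

variable {C D : Type*} [Category* C] [Category* D] [Abelian C] [HasDerivedCategory C]

/-- The objects of the bounded below derived category whose homology is sent to `P` by `F`. -/
def homologyIn (F : C ⥤ D) (P : ObjectProperty D) : ObjectProperty (DerivedCategory.Plus C) :=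
  fun X ↦ ∀ q : ℤ, P (F.obj ((homologyFunctor C q).obj X))

instance (F : C ⥤ D) (P : ObjectProperty D) [P.IsClosedUnderIsomorphisms] :
    (homologyIn F P).IsClosedUnderIsomorphisms where
  of_iso e h q := P.prop_of_iso (F.mapIso ((homologyFunctor C q).mapIso e)) (h q)

/-- The homology of a bounded below complex, computed in the derived category. -/
noncomputable def homologyQhIso (K : CochainComplex.Plus C) (q : ℤ) :
    (homologyFunctor C q).obj (Qh.obj ((HomotopyCategory.Plus.quotient C).obj K)) ≅
      K.obj.homology q :=
  (DerivedCategory.homologyFunctor C q).mapIso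
    ((DerivedCategory.quotientCompQhIso C).app K.obj) ≪≫
    (DerivedCategory.homologyFunctorFactors C q).app K.obj

lemma homologyIn_Qh_iff (F : C ⥤ D) (P : ObjectProperty D) [P.IsClosedUnderIsomorphisms]
    (K : CochainComplex.Plus C) :
    homologyIn F P (Qh.obj ((HomotopyCategory.Plus.quotient C).obj K)) ↔
      ∀ q, P (F.obj (K.obj.homology q)) :=
  forall_congr' fun q ↦ P.prop_iff_of_iso (F.mapIso (homologyQhIso K q))

omit [HasDerivedCategory C] in
/-- A bounded below complex of injectives, as an object of the homotopy category. -/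
abbrev ofInjectives (K : CochainComplex.Plus (InjectiveObject C)) : HomotopyCategory.Plus C :=
  (HomotopyCategory.Plus.quotient C).obj ((InjectiveObject.ι C).mapCochainComplexPlus.obj K)

variable [EnoughInjectives C]

lemma exists_injective_iso (X : DerivedCategory.Plus C) :
    ∃ K, Nonempty (Qh.obj (ofInjectives K) ≅ X) := by
  obtain ⟨n, hn⟩ := X.property
  have : X.IsGE n := (DerivedCategory.Plus.isGE_ι_obj_iff X n).1 hn
  obtain ⟨K, -, e⟩ := DerivedCategory.Plus.exists_injective_nonempty_iso X n
  exact ⟨K, e⟩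

variable {Γ : C ⥤ C} [Γ.Additive]

/-- The natural transformation `RΓ ⟶ 𝟭` induced by `i : Γ ⟶ 𝟭 C`. -/
noncomputable def derivedToId (i : Γ ⟶ 𝟭 C) :
    Γ.rightDerivedFunctorPlus ⟶ 𝟭 (DerivedCategory.Plus C) :=
  Γ.rightDerivedFunctorPlus.rightDerivedDesc Γ.rightDerivedFunctorPlusUnit
    (HomotopyCategory.Plus.quasiIso C) (𝟭 _) (Functor.whiskerRight (homotopyCategoryToId i) Qh)

lemma unit_derivedToId (i : Γ ⟶ 𝟭 C) (K : HomotopyCategory.Plus C) :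
    Γ.rightDerivedFunctorPlusUnit.app K ≫ (derivedToId i).app (Qh.obj K) =
      Qh.map ((homotopyCategoryToId i).app K) :=
  Functor.rightDerived_fac_app _ _ _ _ _ _

namespace IsStableTorsion

variable [Abelian D] {i : Γ ⟶ 𝟭 C} {F : C ⥤ D} {P : ObjectProperty D}

omit [HasDerivedCategory C] [EnoughInjectives C] in
lemma isIso_homotopyCategoryToId (h : IsStableTorsion i F P) (K : HomotopyCategory.Plus C) :
    IsIso ((homotopyCategoryToId i).app (Γ.mapHomotopyCategoryPlus.obj K)) := by
  have (n : ℤ) : IsIso (((cochainComplexToId i).app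
      ((Γ.mapHomologicalComplex (.up ℤ)).obj K.obj.as)).f n) :=
    h.isIso_app (K.obj.as.X n)
  have := HomologicalComplex.Hom.isIso_of_components
    ((cochainComplexToId i).app ((Γ.mapHomologicalComplex (.up ℤ)).obj K.obj.as))
  rw [← isIso_iff_of_reflects_iso _ (HomotopyCategory.Plus.ι C)]
  exact inferInstanceAs (IsIso ((HomotopyCategory.quotient C (.up ℤ)).map
    ((cochainComplexToId i).app ((Γ.mapHomologicalComplex (.up ℤ)).obj K.obj.as))))

omit [HasDerivedCategory C] [EnoughInjectives C] in
lemma isIso_map_homotopyCategoryToId (h : IsStableTorsion i F P) (K : HomotopyCategory.Plus C) :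
    IsIso (Γ.mapHomotopyCategoryPlus.map ((homotopyCategoryToId i).app K)) := by
  let c := (Γ.mapHomologicalComplex (.up ℤ)).map ((cochainComplexToId i).app K.obj.as)
  have (n : ℤ) : IsIso (c.f n) := h.isIso_map_app (K.obj.as.X n)
  have := HomologicalComplex.Hom.isIso_of_components c
  rw [← isIso_iff_of_reflects_iso _ (HomotopyCategory.Plus.ι C)]
  exact inferInstanceAs (IsIso ((HomotopyCategory.quotient C (.up ℤ)).map c))

variable [PreservesFiniteLimits F] [PreservesFiniteColimits F] [P.IsSerreClass]

lemma homologyIn_derived (h : IsStableTorsion i F P) (X : DerivedCategory.Plus C) :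
    homologyIn F P (Γ.rightDerivedFunctorPlus.obj X) := by
  obtain ⟨K, ⟨e⟩⟩ := exists_injective_iso X
  let u := Γ.rightDerivedFunctorPlusUnit.app (ofInjectives K)
  have hu : IsIso u := by dsimp only [u]; infer_instance
  refine (homologyIn F P).prop_of_iso (asIso u ≪≫ Γ.rightDerivedFunctorPlus.mapIso e) ?_
  exact (homologyIn_Qh_iff F P (Γ.mapCochainComplexPlus.obj
    ((InjectiveObject.ι C).mapCochainComplexPlus.obj K))).2 (h.prop_homology _)

variable [F.Additive] [F.Faithful]

lemma isIso_derivedToId (h : IsStableTorsion i F P) {X : DerivedCategory.Plus C}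
    (hX : homologyIn F P X) : IsIso ((derivedToId i).app X) := by
  obtain ⟨K, ⟨e⟩⟩ := exists_injective_iso X
  obtain ⟨n, hn⟩ := K.property
  let K' := (InjectiveObject.ι C).mapCochainComplexPlus.obj K
  have : K'.obj.IsStrictlyGE n := by
    have : K.obj.IsStrictlyGE n := hn
    exact inferInstanceAs (CochainComplex.IsStrictlyGE
      (((InjectiveObject.ι C).mapHomologicalComplex (.up ℤ)).obj K.obj) n)
  have hK' : ∀ q, P (F.obj (K'.obj.homology q)) :=
    (homologyIn_Qh_iff F P K').1 ((homologyIn F P).prop_of_iso e.symm hX)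
  have hi : HomotopyCategory.Plus.quasiIso C
      ((homotopyCategoryToId i).app (ofInjectives K)) :=
    (HomotopyCategory.quotient_map_mem_quasiIso_iff _).2 (h.quasiIso K'.obj n
      (fun m ↦ inferInstanceAs (Injective (K.obj.X m).obj)) hK')
  have hQh := Localization.inverts Qh (HomotopyCategory.Plus.quasiIso C) _ hi
  rw [← unit_derivedToId] at hQh
  rw [← NatTrans.isIso_app_iff_of_iso (derivedToId i) e]
  exact (isIso_comp_left_iff _ _).1 hQh

lemma isIso_map_derivedToId (h : IsStableTorsion i F P) (X : DerivedCategory.Plus C) :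
    IsIso (Γ.rightDerivedFunctorPlus.map ((derivedToId i).app X)) := by
  obtain ⟨K, ⟨e⟩⟩ := exists_injective_iso X
  let u := Γ.rightDerivedFunctorPlusUnit
  let K₀ := ofInjectives K
  let Z := Γ.mapHomotopyCategoryPlus.obj K₀
  have hu : IsIso (u.app K₀) := by dsimp only [u, K₀]; infer_instance
  have huZ : IsIso (u.app Z) := by
    have hZ : IsIso ((derivedToId i).app (Qh.obj Z)) :=
      h.isIso_derivedToId ((homologyIn F P).prop_of_iso (asIso (u.app K₀)).symm
        (h.homologyIn_derived _))
    have hcomp : IsIso (u.app Z ≫ (derivedToId i).app (Qh.obj Z)) := by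
      have := h.isIso_homotopyCategoryToId K₀
      rw [unit_derivedToId]
      infer_instance
    exact (isIso_comp_right_iff _ _).1 hcomp
  have hmap : IsIso (Γ.rightDerivedFunctorPlus.map (Qh.map ((homotopyCategoryToId i).app K₀))) := by
    have := h.isIso_map_homotopyCategoryToId K₀
    have comm : Qh.map (Γ.mapHomotopyCategoryPlus.map ((homotopyCategoryToId i).app K₀)) ≫
        u.app K₀ = u.app Z ≫ Γ.rightDerivedFunctorPlus.map
          (Qh.map ((homotopyCategoryToId i).app K₀)) :=
      u.naturality _
    rw [← isIso_comp_left_iff (u.app Z), ← comm]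
    exact IsIso.comp_isIso
  rw [← unit_derivedToId, Functor.map_comp] at hmap
  exact (NatTrans.isIso_app_iff_of_iso
    (Functor.whiskerRight (derivedToId i) Γ.rightDerivedFunctorPlus) e).1
    ((isIso_comp_left_iff _ _).1 hmap)

lemma isCoreflection (h : IsStableTorsion i F P) :
    IsCoreflection (derivedToId i) (homologyIn F P) where
  prop_obj := h.homologyIn_derived
  isIso_app := h.isIso_derivedToId
  isIso_map_app := h.isIso_map_derivedToId

end IsStableTorsion

end Derived

section Torsion

variable {S : Type u} [Ring S] {P : ObjectProperty (ModuleCat.{u} S)} [IsLocalizing P]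
  {M N : Type u} [AddCommGroup M] [Module S M] [AddCommGroup N] [Module S N]

lemma prop_of_injective {f : M →ₗ[S] N} (hf : Function.Injective f) (h : P (ModuleCat.of S N)) :
    P (ModuleCat.of S M) :=
  have := (ModuleCat.mono_iff_injective (ModuleCat.ofHom f)).2 hf
  P.prop_of_mono (ModuleCat.ofHom f) h

lemma IsSupported.of_injective {f : M →ₗ[S] N} (hf : Function.Injective f) {m : M}
    (h : IsSupported P (f m)) : IsSupported P m := by
  have hle : ∀ x ∈ Submodule.span S {m}, f x ∈ Submodule.span S {f m} := fun x hx ↦ by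
    have := Submodule.mem_map_of_mem (f := f) hx
    rwa [Submodule.map_span, Set.image_singleton] at this
  have hinj : Function.Injective (f.restrict hle) := fun x y hxy ↦
    Subtype.ext (hf (congr_arg Subtype.val hxy))
  exact prop_of_injective hinj h

lemma prop_of_forall_isSupported (h : ∀ m : M, IsSupported P m) : P (ModuleCat.of S M) := by
  have := IsLocalizing.closedUnderDirectSums (P := P) M
  let X (m : M) : ModuleCat.{u} S := ModuleCat.of S (Submodule.span S {m})
  let p : ∐ X ⟶ ModuleCat.of S M :=
    Sigma.desc fun m ↦ ModuleCat.ofHom (Submodule.span S {m}).subtype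
  have : Epi p := (ModuleCat.epi_iff_surjective p).2 fun m ↦
    ⟨Sigma.ι X m ⟨m, Submodule.mem_span_singleton_self m⟩, by
      rw [← ModuleCat.comp_apply, Sigma.ι_desc]
      rfl⟩
  exact P.prop_of_epi p (P.prop_colimit _ fun m ↦ h m.as)

variable (P M) in
/-- The torsion submodule of `M`, i.e. its largest submodule belonging to `P`. -/
def torsionSubmodule : Submodule S M where
  carrier := {m | IsSupported P m}
  add_mem' := IsSupported.add
  zero_mem' := IsSupported.zero P
  smul_mem' a _ h := h.smul a

lemma prop_torsionSubmodule : P (ModuleCat.of S (torsionSubmodule P M)) :=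
  prop_of_forall_isSupported fun m ↦
    IsSupported.of_injective (torsionSubmodule P M).injective_subtype m.2

lemma mem_torsionSubmodule_of_prop (h : P (ModuleCat.of S M)) (f : M →ₗ[S] N) (m : M) :
    f m ∈ torsionSubmodule P N :=
  (IsSupported.of_prop h m).map f

lemma torsionSubmodule_eq_top (h : P (ModuleCat.of S M)) : torsionSubmodule P M = ⊤ :=
  eq_top_iff.2 fun m _ ↦ IsSupported.of_prop h m

end Torsion

section Stable

variable {S : Type u} [Ring S]

lemma exists_maximal_disjoint {M : Type*} [AddCommGroup M] [Module S M] (T : Submodule S M) :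
    ∃ C : Submodule S M, Maximal (Disjoint T) C := by
  obtain ⟨C, -, hC⟩ := zorn_le_nonempty₀ {C : Submodule S M | Disjoint T C}
    (fun c hc hchain C _ ↦ ⟨sSup c,
      (DirectedOn.disjoint_sSup_right hchain.directedOn).2 hc, fun _ hz ↦ le_sSup hz⟩)
    ⊥ disjoint_bot_right
  exact ⟨C, hC⟩

lemma injective_mkQ_comp_subtype {M : Type*} [AddCommGroup M] [Module S M] {T C : Submodule S M}
    (h : Disjoint T C) : Function.Injective (C.mkQ ∘ₗ T.subtype) := by
  rwa [← LinearMap.ker_eq_bot, LinearMap.ker_comp, C.ker_mkQ,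
    ← Submodule.disjoint_iff_comap_eq_bot]

lemma isEssentialSubmodule_map_mkQ {M : Type u} [AddCommGroup M] [Module S M]
    {T C : Submodule S M} (h : Maximal (Disjoint T) C) :
    IsEssentialSubmodule (T.map C.mkQ) := by
  intro U hU hbot
  rw [Submodule.map_inf_eq_map_inf_comap, ← LinearMap.le_ker_iff_map, C.ker_mkQ] at hbot
  have hd : Disjoint T (U.comap C.mkQ) :=
    disjoint_iff_inf_le.2 ((le_inf inf_le_left hbot).trans h.prop.le_bot)
  apply hU
  rw [← Submodule.map_comap_eq_of_surjective C.mkQ_surjective U, ← LinearMap.le_ker_iff_map,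
    C.ker_mkQ]
  exact h.le_of_ge hd (C.le_comap_mkQ U)

variable {P : ObjectProperty (ModuleCat.{u} S)} [IsLocalizing P]

-- The inclusion `T → E` of the torsion submodule extends along `T → E ⧸ C` to a map with values in
-- `T`, since `E ⧸ C` is torsion by stability.
lemma injective_torsionSubmodule (hP : IsStable P) (E : Type u) [AddCommGroup E] [Module S E]
    [Injective (ModuleCat.of S E)] : Injective (ModuleCat.of S (torsionSubmodule P E)) := by
  obtain ⟨C, hC⟩ := exists_maximal_disjoint (torsionSubmodule P E)
  have hEC : P (ModuleCat.of S (E ⧸ C)) :=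
    hP _ _ (isEssentialSubmodule_map_mkQ hC) (prop_map _ prop_torsionSubmodule)
  let j := ModuleCat.ofHom (torsionSubmodule P E).subtype
  let q := ModuleCat.ofHom (C.mkQ ∘ₗ (torsionSubmodule P E).subtype)
  have : Mono q := (ModuleCat.mono_iff_injective q).2 (injective_mkQ_comp_subtype hC.prop)
  let g : E ⧸ C →ₗ[S] E := (Injective.factorThru j q).hom
  have hg (t : torsionSubmodule P E) : g (C.mkQ t) = t :=
    ConcreteCategory.congr_hom (Injective.comp_factorThru j q) t
  let r : E →ₗ[S] torsionSubmodule P E :=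
    g.codRestrict _ (mem_torsionSubmodule_of_prop hEC g) ∘ₗ C.mkQ
  exact Retract.injective
    { i := j
      r := ModuleCat.ofHom r
      retract := by
        ext t
        exact hg t }

variable {E : ShortComplex (ModuleCat.{u} S)}

lemma injective_X₁_of_isStable (hP : IsStable P) (hE : E.ShortExact) [Injective E.X₂]
    (hT : LinearMap.range E.f.hom = torsionSubmodule P E.X₂) : Injective E.X₁ := by
  have : Injective (ModuleCat.of S E.X₂) := ‹Injective E.X₂›
  have := injective_torsionSubmodule hP E.X₂
  let e := (LinearEquiv.ofInjective E.f.hom ((ModuleCat.mono_iff_injective _).1 hE.mono_f)).trans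
    (LinearEquiv.ofEq _ _ hT)
  exact Injective.of_iso e.symm.toModuleIso this

lemma rightOrthogonal_X₃ (hE : E.ShortExact) [Injective E.X₁]
    (hT : LinearMap.range E.f.hom = torsionSubmodule P E.X₂) : P.rightOrthogonal E.X₃ := by
  intro W g hW
  ext w
  let s := retractOfInjective hE
  have hw : (g ≫ s.i) w ∈ LinearMap.range E.f.hom :=
    hT ▸ mem_torsionSubmodule_of_prop hW (g ≫ s.i).hom w
  obtain ⟨y, hy⟩ := hw
  calc
    g w = E.g ((g ≫ s.i) w) := (ConcreteCategory.congr_hom s.retract (g w)).symm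
    _ = E.g (E.f y) := congr_arg E.g hy.symm
    _ = 0 := ConcreteCategory.congr_hom E.zero y

end Stable

section RestrictScalars

variable {S R : Type u} [Ring S] [Ring R] (φ : S →+* R)

lemma restrictScalars_map_exact {E : ShortComplex (ModuleCat.{u} R)} (hE : E.Exact) :
    (E.map (ModuleCat.restrictScalars.{u} φ)).Exact := by
  rw [ShortComplex.ShortExact.moduleCat_exact_iff_function_exact] at hE ⊢
  exact hE

instance : PreservesFiniteLimits (ModuleCat.restrictScalars.{u} φ) :=
  (((ModuleCat.restrictScalars.{u} φ).exact_tfae.out 1 3).1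
    fun _ ↦ restrictScalars_map_exact φ : _ ∧ _).1

instance : PreservesFiniteColimits (ModuleCat.restrictScalars.{u} φ) :=
  (((ModuleCat.restrictScalars.{u} φ).exact_tfae.out 1 3).1
    fun _ ↦ restrictScalars_map_exact φ : _ ∧ _).2

variable {φ} {Γ : ModuleCat.{u} R ⥤ ModuleCat.{u} R} {i : Γ ⟶ 𝟭 _}
  {P : ObjectProperty (ModuleCat.{u} S)} [IsLocalizing P]

lemma isStableTorsion_of_isStable [(ModuleCat.restrictScalars.{u} φ).PreservesInjectiveObjects]
    (hP : IsStable P) (hi : ∀ X, Mono (i.app X))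
    (hΓ : ∀ X, LinearMap.range ((ModuleCat.restrictScalars.{u} φ).map (i.app X)).hom =
      torsionSubmodule P ((ModuleCat.restrictScalars.{u} φ).obj X)) :
    IsStableTorsion i (ModuleCat.restrictScalars.{u} φ) P := by
  let F := ModuleCat.restrictScalars.{u} φ
  have hinj (X) : Function.Injective (F.map (i.app X)).hom :=
    (ModuleCat.mono_iff_injective _).1 (inferInstanceAs (Mono (F.map (i.app X))))
  have prop_obj (X) : P (F.obj (Γ.obj X)) :=
    prop_of_forall_isSupported (M := F.obj (Γ.obj X)) fun y ↦ IsSupported.of_injective (hinj X)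
      ((hΓ X).le ⟨y, rfl⟩)
  have surjective (X) : Function.Surjective (F.map (i.app (Γ.obj X))).hom :=
    LinearMap.range_eq_top.1 ((hΓ (Γ.obj X)).trans (torsionSubmodule_eq_top (prop_obj X)))
  let E (X) := (ShortComplex.mk _ _ (cokernel.condition (i.app X))).map F
  have hE (X) : (E X).ShortExact := ShortComplex.ShortExact.map_of_exact
    { exact := ShortComplex.exact_cokernel _
      mono_f := hi X
      epi_g := inferInstanceAs (Epi (cokernel.π _)) } F
  have injective_X₂ (X) [Injective X] : Injective (E X).X₂ :=
    inferInstanceAs (Injective (F.obj X))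
  have injective_X₁ (X) [Injective X] : Injective (E X).X₁ :=
    have := injective_X₂ X
    injective_X₁_of_isStable hP (hE X) (hΓ X)
  exact
    { mono_app := hi
      isIso_app X :=
        have : Epi (i.app (Γ.obj X)) := (ModuleCat.epi_iff_surjective _).2 (surjective X)
        have := hi (Γ.obj X)
        isIso_of_mono_of_epi _
      prop_obj
      rightOrthogonal X _ :=
        have := injective_X₁ X
        rightOrthogonal_X₃ (hE X) (hΓ X)
      injective X _ :=
        have := injective_X₁ X
        have := injective_X₂ X
        (retractOfInjective (hE X)).injective }

end RestrictScalars

section Induction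

variable {K : Type v} [CommRing K] {A C : Type u} [Ring A] [Ring C] [Algebra K A] [Algebra K C]

section Module

variable {X Y N : Type u} [AddCommGroup X] [Module K X] [Module C X] [IsScalarTower K C X]
  [AddCommGroup Y] [Module K Y] [Module C Y] [IsScalarTower K C Y]
  [AddCommGroup N] [Module (A ⊗[K] C) N]

variable (K A C X) in
/-- The `A ⊗[K] C`-module induced by a `C`-module `X`, on the abelian group `A ⊗[K] X`. It is a
model of `(A ⊗[K] C) ⊗[C] X`, a tensor product over a noncommutative ring. -/
abbrev inducedModule : Module (A ⊗[K] C) (A ⊗[K] X) :=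
  Module.compHom (A ⊗[K] X) (((Module.endTensorEndAlgHom (R := K) (S := K) (A := K) (M := A)
    (N := X)).comp (Algebra.TensorProduct.map (Algebra.lmul K A) (Algebra.lsmul K K X :
      C →ₐ[K] Module.End K X))).toRingHom)

attribute [local instance] inducedModule

lemma tmul_smul_tmul (a a' : A) (c : C) (x : X) :
    (a ⊗ₜ[K] c) • (a' ⊗ₜ[K] x) = (a * a') ⊗ₜ[K] (c • x) := rfl

lemma map_smul_of_tmul {f : A ⊗[K] X →+ N}
    (hf : ∀ (a a' : A) (c : C) (x : X),
      f ((a * a') ⊗ₜ[K] (c • x)) = (a ⊗ₜ[K] c) • f (a' ⊗ₜ[K] x))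
    (r : A ⊗[K] C) (t : A ⊗[K] X) : f (r • t) = r • f t := by
  induction t using TensorProduct.induction_on with
  | zero => rw [smul_zero, map_zero, smul_zero]
  | add t t' ht ht' => rw [smul_add, map_add, ht, ht', map_add, smul_add]
  | tmul a' x =>
    induction r using TensorProduct.induction_on with
    | zero => rw [zero_smul, map_zero, zero_smul]
    | add r r' hr hr' => rw [add_smul, map_add, hr, hr', add_smul]
    | tmul a c => exact hf a a' c x

/-- Induction of modules on morphisms. -/
def inducedMap (f : X →ₗ[C] Y) : A ⊗[K] X →ₗ[A ⊗[K] C] A ⊗[K] Y where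
  __ := (f.restrictScalars K).lTensor A
  map_smul' := map_smul_of_tmul (f := ((f.restrictScalars K).lTensor A).toAddMonoidHom)
    fun a a' c x ↦ congr_arg ((a * a') ⊗ₜ[K] ·) (f.map_smul c x)

/-- The `A ⊗[K] C`-linear map out of an induced module which extends a `C`-linear map. -/
def inducedLift
    (f : X →ₛₗ[(Algebra.TensorProduct.includeRight : C →ₐ[K] A ⊗[K] C).toRingHom] N) :
    A ⊗[K] X →ₗ[A ⊗[K] C] N :=
  let l : A ⊗[K] X →+ N := TensorProduct.liftAddHom
    (((smulAddHom (A ⊗[K] C) N).comp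
      (Algebra.TensorProduct.includeLeft : A →ₐ[K] A ⊗[K] C).toRingHom.toAddMonoidHom).compl₂
      f.toAddMonoidHom)
    (fun k a x ↦ by
      change ((k • a) ⊗ₜ[K] (1 : C)) • f x = (a ⊗ₜ[K] (1 : C)) • f (k • x)
      rw [← algebraMap_smul C k x, map_smulₛₗ]
      change _ = (a ⊗ₜ[K] (1 : C)) • ((1 : A) ⊗ₜ[K] algebraMap K C k) • f x
      rw [smul_smul, Algebra.TensorProduct.tmul_mul_tmul, mul_one, one_mul,
        Algebra.algebraMap_eq_smul_one, TensorProduct.tmul_smul, TensorProduct.smul_tmul'])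
  { l with
    map_smul' := map_smul_of_tmul (f := l) fun a a' c x ↦ by
      change ((a * a') ⊗ₜ[K] (1 : C)) • f (c • x) = (a ⊗ₜ[K] c) • (a' ⊗ₜ[K] (1 : C)) • f x
      rw [map_smulₛₗ]
      change _ • ((1 : A) ⊗ₜ[K] c) • f x = _
      rw [smul_smul, smul_smul]
      simp }

/-- The universal property of the induced module. -/
def inducedHomEquiv : (A ⊗[K] X →ₗ[A ⊗[K] C] N) ≃
    (X →ₛₗ[(Algebra.TensorProduct.includeRight : C →ₐ[K] A ⊗[K] C).toRingHom] N) where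
  toFun g :=
    { toFun x := g (1 ⊗ₜ x)
      map_add' x y := by rw [TensorProduct.tmul_add, map_add]
      map_smul' c x := by
        rw [← one_mul (1 : A), ← tmul_smul_tmul, map_smul, one_mul]
        rfl }
  invFun := inducedLift
  left_inv g := LinearMap.ext fun t ↦ by
    induction t using TensorProduct.induction_on with
    | zero => rw [map_zero, map_zero]
    | add t t' ht ht' => rw [map_add, ht, ht', map_add]
    | tmul a x =>
      change (a ⊗ₜ[K] (1 : C)) • g (1 ⊗ₜ x) = g (a ⊗ₜ x)
      rw [← map_smul, tmul_smul_tmul, mul_one, one_smul]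
  right_inv f := LinearMap.ext fun x ↦ one_smul (A ⊗[K] C) (f x)

end Module

section Functor

/-- The `K`-module structure underlying a module over a `K`-algebra. -/
abbrev underlyingModule (X : ModuleCat.{u} C) : Module K X := .restrictScalars K C X

attribute [local instance] underlyingModule

lemma isScalarTower_underlyingModule (X : ModuleCat.{u} C) : IsScalarTower K C X :=
  .restrictScalars K C X

attribute [local instance] inducedModule isScalarTower_underlyingModule

variable (K A C) in
/-- Induction of modules along `C → A ⊗[K] C`. -/
def induction : ModuleCat.{u} C ⥤ ModuleCat.{u} (A ⊗[K] C) where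
  obj X := ModuleCat.of _ (A ⊗[K] X)
  map f := ModuleCat.ofHom (inducedMap f.hom)
  map_id X := by
    ext t
    exact LinearMap.lTensor_id_apply A X t
  map_comp f g := by
    ext t
    exact LinearMap.lTensor_comp_apply A (g.hom.restrictScalars K) (f.hom.restrictScalars K) t

instance [Module.Flat K A] : (induction K A C).PreservesMonomorphisms where
  preserves f hf := (ModuleCat.mono_iff_injective _).2
    (Module.Flat.lTensor_preserves_injective_linearMap (f.hom.restrictScalars K)
      ((ModuleCat.mono_iff_injective f).1 hf))

variable (K A C) in
/-- Induction of modules is left adjoint to restriction of scalars. -/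
noncomputable def inductionAdj : induction K A C ⊣ ModuleCat.restrictScalars.{u}
    (Algebra.TensorProduct.includeRight : C →ₐ[K] A ⊗[K] C).toRingHom :=
  .mkOfHomEquiv
    { homEquiv X N := ModuleCat.homEquiv.trans (inducedHomEquiv.trans
        (ModuleCat.semilinearMapAddEquiv _ X N).toEquiv)
      homEquiv_naturality_left_symm {_ _ N} f g := (Equiv.symm_apply_eq _).2 <| by
        ext x
        exact (one_smul (A ⊗[K] C) (g (f x) : N)).symm
      homEquiv_naturality_right f g := rfl }

instance [Module.Flat K A] : Functor.PreservesInjectiveObjects (ModuleCat.restrictScalars.{u}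
    (Algebra.TensorProduct.includeRight : C →ₐ[K] A ⊗[K] C).toRingHom) :=
  Functor.preservesInjectiveObjects_of_adjunction_of_preservesMonomorphisms (inductionAdj K A C)

instance [Module.Flat K C] : Functor.PreservesInjectiveObjects (ModuleCat.restrictScalars.{u}
    (Algebra.TensorProduct.includeLeft : A →ₐ[K] A ⊗[K] C).toRingHom) where
  injective_obj {I} _ :=
    let e := (Algebra.TensorProduct.comm K C A).toRingEquiv
    have hcomp : (Algebra.TensorProduct.includeLeft : A →ₐ[K] A ⊗[K] C).toRingHom =
        e.toRingHom.comp (Algebra.TensorProduct.includeRight : A →ₐ[K] C ⊗[K] A).toRingHom :=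
      rfl
    Injective.of_iso ((ModuleCat.restrictScalarsComp'.{u} _ _ _ hcomp).symm.app I) inferInstance

end Functor

end Induction

section Comparison

variable {K : Type v} [CommRing K] {A B : Type u} [Ring A] [Ring B] [Algebra K A] [Algebra K B]

variable (K B) in
/-- The inclusion of the torsion functor `Γ_P` into the identity. -/
def leftΓι (P : ObjectProperty (ModuleCat.{u} A)) [IsLocalizing P] :
    leftΓ K B P ⟶ 𝟭 (Bimod K A B) where
  app X := ModuleCat.ofHom (leftTorsion P X).subtype

variable (K A) in
/-- The inclusion of the torsion functor `Γ_Q` into the identity. -/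
def rightΓι (Q : ObjectProperty (ModuleCat.{u} Bᵐᵒᵖ)) [IsLocalizing Q] :
    rightΓ K A Q ⟶ 𝟭 (Bimod K A B) where
  app X := ModuleCat.ofHom (rightTorsion Q X).subtype

variable (K B) in
lemma isStableTorsion_leftΓι [Module.Flat K B] {P : ObjectProperty (ModuleCat.{u} A)}
    [IsLocalizing P] (hP : IsStable P) :
    IsStableTorsion (leftΓι K B P) (forgetToLeft K A B) P :=
  have : Module.Flat K Bᵐᵒᵖ := .of_linearEquiv (MulOpposite.opLinearEquiv K).symm
  isStableTorsion_of_isStable hP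
    (fun X ↦ (ModuleCat.mono_iff_injective _).2 (leftTorsion P X).injective_subtype)
    fun _ ↦ SetLike.coe_injective Subtype.range_coe

variable (K A) in
lemma isStableTorsion_rightΓι [Module.Flat K A] {Q : ObjectProperty (ModuleCat.{u} Bᵐᵒᵖ)}
    [IsLocalizing Q] (hQ : IsStable Q) :
    IsStableTorsion (rightΓι K A Q) (forgetToRight K A B) Q :=
  isStableTorsion_of_isStable hQ
    (fun X ↦ (ModuleCat.mono_iff_injective _).2 (rightTorsion Q X).injective_subtype)
    fun _ ↦ SetLike.coe_injective Subtype.range_coe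

end Comparison

end BimoduleSupport

open BimoduleSupport in
theorem theorem1p1_general {K : Type v} [CommRing K] {A B : Type u} [Ring A] [Ring B]
    [Algebra K A] [Algebra K B] [Module.Flat K A] [Module.Flat K B]
    [HasDerivedCategory.{w} (Bimod K A B)]
    (P : ObjectProperty (ModuleCat.{u} A)) [IsLocalizing P]
    (Q : ObjectProperty (ModuleCat.{u} Bᵐᵒᵖ)) [IsLocalizing Q]
    (hP : IsStable P) (hQ : IsStable Q) :
    Nonempty
      ((crossSupported K P Q).ι ⋙ leftRΓ K B P ≅ (crossSupported K P Q).ι ⋙ rightRΓ K A Q) :=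
  ⟨coreflectionIso (crossSupported K P Q).ι
    (isStableTorsion_leftΓι K B hP).isCoreflection (isStableTorsion_rightΓι K A hQ).isCoreflection
    (fun X q ↦ (X.property q).1) (fun X q ↦ (X.property q).2)⟩

open BimoduleSupport in
/-- The isomorphism is natural on the full subcategory of all `X` satisfying the condition on
cohomology with supports, and lives in the (unbounded) derived category of bimodules. -/
theorem theorem1p1 {K : Type v} [CommRing K] {A B : Type u} [Ring A] [Ring B]
    [Algebra K A] [Algebra K B] [Module.Flat K A] [Module.Flat K B]
    [HasDerivedCategory.{w} (Bimod K A B)]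
    (P : ObjectProperty (ModuleCat.{u} A)) [IsLocalizing P]
    (Q : ObjectProperty (ModuleCat.{u} Bᵐᵒᵖ)) [IsLocalizing Q]
    (hP : IsStable P) (hP' : IsLocallyFinitelyResolved P)
    (hQ : IsStable Q) (hQ' : IsLocallyFinitelyResolved Q) :
    Nonempty
      ((crossSupported K P Q).ι ⋙ leftRΓ K B P ⋙ DerivedCategory.Plus.ι ≅
        (crossSupported K P Q).ι ⋙ rightRΓ K A Q ⋙ DerivedCategory.Plus.ι) :=
  (theorem1p1_general P Q hP hQ).map fun e ↦ Functor.isoWhiskerRight e DerivedCategory.Plus.ι
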